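/- Fix an integer $k\ge 2$ and let $\mathbf a=(a_i)_{i\ge 0}$ be a $k$-automatic sequence: there is a deterministic finite automaton with output which, after reading the base-$k$ representation of $i$ (most significant digit first, without leading zeros), is in a state with output $a_i$. For a finite nonempty word $w$ and a real number $\beta\ge 1$ let $w^\beta$ be the shortest prefix of $w^\omega=www\cdots$ of length at least $\beta|w|$, and put $$c_2(\mathbf a):=\sup\{\beta\ge 1 : \forall N\ge 1\ \exists w \text{ with } |w|\ge N \text{ and } w^\beta \text{ a factor of } \mathbf a\}\in[1,\infty].$$ Then: (1) $c_2(\mathbf a)$ is either rational or infinite. (2) $c_2(\mathbf a)$ is the largest special point of $\mathrm{quo}_k(L')$. Here $L'$ is the set of the canonical base-$k$ encodings $(q,p)_k$, over the alphabet $\{0,\dots,k-1\}^2$, of the pairs $(q,p)$ with $1\le p\le q$ such that $\mathbf a$ has a factor of length $q$ with period $p$. The canonical encoding of a pair pads the shorter of the two representations with leading zeros and reads both in parallel. For a word $x$ over $\{0,\dots,k-1\}^2$, $\mathrm{quo}_k(x)$ is the quotient of the integer represented by the first components of $x$ by the integer represented by the second components (so $\mathrm{quo}_k((q,p)_k)=q/p$).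 An extended real number $\beta$ is a special point of $\mathrm{quo}_k(L)$ if there is an infinite sequence $(x_j)_{j\ge1}$ of distinct words of $L$ with $\lim_{j\to\infty}\mathrm{quo}_k(x_j)=\beta$. (3) $c_2(\mathbf a)$ is computable: there is a single algorithm which, given the base $k\ge2$ and a finite automaton with output (with outputs in $\mathbb N$, described by its start state, transition table and list of outputs) generating a $k$-automatic sequence $\mathbf a$, decides whether $c_2(\mathbf a)=\infty$ and, if not, outputs $c_2(\mathbf a)$ as a fraction of integers. -/

import Mathlib

open Filter Topology

namespace AutSeq

/-! ### Base-`k` representations, most significant digit first -/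

/-- The canonical encoding `(n)_k`: base `k`, most significant digit first, no leading zeros
(so `0` is encoded by the empty word). For `2 ≤ k` every digit is `< k`, and `Fin.ofNat k`
merely views it as an element of `Fin k`. -/
def natWord (k : ℕ) [NeZero k] (n : ℕ) : List (Fin k) :=
  ((Nat.digits k n).map (Fin.ofNat k)).reverse

/-- The canonical encoding `(m, n)_k` of a pair: the shorter of the two encodings is padded with
leading zeros, and the two are then read in parallel. -/
def pairWord (k : ℕ) [NeZero k] (m n : ℕ) : List (Fin k × Fin k) :=
  let len := max (natWord k m).length (natWord k n).length
  ((natWord k m).leftpad len 0).zip ((natWord k n).leftpad len 0)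

/-- `[w]_k`, the integer represented by the word `w` (most significant digit first). -/
def wordVal {k : ℕ} (w : List (Fin k)) : ℕ :=
  Nat.ofDigits k (w.map Fin.val).reverse

/-- `quo_k x = [π₁ x]_k / [π₂ x]_k`, used only for words with `[π₂ x]_k ≠ 0`. -/
def quo {k : ℕ} (x : List (Fin k × Fin k)) : ℚ :=
  (wordVal (x.map Prod.fst) : ℚ) / (wordVal (x.map Prod.snd) : ℚ)

/-- `β` is a special point of `quo_k L`: there is an infinite sequence of distinct words of `L`
whose quotients tend to the extended real number `β`. -/
def IsSpecialPoint {k : ℕ} (L : Set (List (Fin k × Fin k))) (β : EReal) : Prop :=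
  ∃ x : ℕ → List (Fin k × Fin k), Function.Injective x ∧ (∀ j, x j ∈ L) ∧
    Tendsto (fun j => (((quo (x j) : ℚ) : ℝ) : EReal)) atTop (𝓝 β)

/-! ### Automatic sequences -/

/-- A deterministic finite automaton with output, over the input alphabet `{0, …, k-1}`, with
states `0, …, n-1` and outputs in `Δ`. -/
structure DFAO (k n : ℕ) (Δ : Type*) where
  start : Fin n
  step : Fin n → Fin k → Fin n
  out : Fin n → Δ

/-- The sequence generated by an automaton: the `i`-th term is the output of the state reached
after reading `(i)_k`. -/
def DFAO.seq {k n : ℕ} {Δ : Type*} [NeZero k] (M : DFAO k n Δ) (i : ℕ) : Δ :=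
  M.out ((natWord k i).foldl M.step M.start)

/-- The sequence `a` is `k`-automatic. -/
def IsAutomatic (k : ℕ) [NeZero k] {Δ : Type*} (a : ℕ → Δ) : Prop :=
  ∃ (n : ℕ) (M : DFAO k n Δ), M.seq = a

/-- The finite description of an automaton that is given to an algorithm: the base, the start
state, the transition table (one row for each state, one column for each digit) and the list of
outputs. -/
def DFAO.code {k n : ℕ} (M : DFAO k n ℕ) : ℕ × ℕ × List (List ℕ) × List ℕ :=
  (k, (M.start : ℕ), List.ofFn (fun s => List.ofFn (fun d => (M.step s d : ℕ))),
    List.ofFn M.out)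

/-! ### Factors, powers and the exponent `c₂` -/

/-- The factor `a[i..i+n-1]`. -/
def factorAt {Δ : Type*} (a : ℕ → Δ) (i n : ℕ) : List Δ :=
  (List.range n).map (fun j => a (i + j))

/-- The finite word `w` is a factor of the sequence `a`. -/
def IsFactor {Δ : Type*} (w : List Δ) (a : ℕ → Δ) : Prop :=
  ∃ i, factorAt a i w.length = w

/-- `w ^ β` for a real `β ≥ 1`: the shortest prefix of `w ^ ω` of length at least `β * |w|`, that
is, the prefix of length `⌈β * |w|⌉`. That length is at most `⌈β⌉ * |w|`, so the prefix can be
taken in `w ^ ⌈β⌉`. -/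
noncomputable def wordPow {Δ : Type*} (w : List Δ) (β : ℝ) : List Δ :=
  (List.replicate ⌈β⌉₊ w).flatten.take ⌈β * (w.length : ℝ)⌉₊

/-- `c₂ a`: the supremum, in the extended reals, of the real `β ≥ 1` such that there are
arbitrarily long words `w` for which `w ^ β` is a factor of `a`. -/
noncomputable def c₂ {Δ : Type*} (a : ℕ → Δ) : EReal :=
  sSup {b : EReal | ∃ β : ℝ, b = (β : EReal) ∧ 1 ≤ β ∧
    ∀ N : ℕ, 1 ≤ N → ∃ w : List Δ, N ≤ w.length ∧ IsFactor (wordPow w β) a}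

/-- The language `L'` of the encodings `(q, p)_k` such that some factor of `a` has length `q` and
period `p`, where `1 ≤ p ≤ q`. -/
def periodLang (k : ℕ) [NeZero k] {Δ : Type*} (a : ℕ → Δ) : Set (List (Fin k × Fin k)) :=
  {x | ∃ w : List Δ, ∃ p : ℕ, IsFactor w a ∧ 1 ≤ p ∧ p ≤ w.length ∧ w.HasPeriod p ∧
    x = pairWord k w.length p}

/-- The extended real described by the output of an algorithm: `none` stands for `∞`, and
`some (m, n)` for the fraction `m / n`. -/
noncomputable def outputVal : Option (ℕ × ℕ) → EReal
  | none => ⊤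
  | some (m, n) => (((m : ℝ) / (n : ℝ) : ℝ) : EReal)

end AutSeq

/-! Let S be the set of pairs (q, p) with 1 ≤ p ≤ q such that some factor of length q has period p.
A finite automaton reading the base-k digits of q and p in parallel recognizes S
(`DFAO.recognizes`): compare the letters at u and u + p inside the window, then eliminate u and the
position i by subset constructions. Automata appear as state maps on tuples of integers, compatible
with appending digits, so leading zeros need no care.

Pumping then controls q/p. If N bounds the number of states and q is large, a block can be cut out
of the first N digits, which gives (q, p) = (q', p') + c(D₁, D₂) with (q', p') in S and (D₁, D₂) in
a finite set of slopes (`Recognizes.exists_isSlope`). If all D₂ are positive, induction shows that q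
exceeds p times the largest D₁/D₂ by at most a constant (`Recognizes.mul_le`); this bounds c₂ and
every special point. Conversely, repeating the block gives points of S going to infinity on a line
of direction (D₁, D₂) (`IsLasso.exists_seq`), so c₂ and the largest special point both equal the
largest slope. A slope with D₂ = 0 makes both infinite.

Slopes have witnesses of bounded size, and membership in S is decidable because the position can be
bounded (`DFAO.hasRepetition_iff`). Hence a bounded search computes the value. -/

namespace AutSeq

/-- `a` has a factor of length `q` with period `p`, where `1 ≤ p ≤ q`. -/
def HasRepetition {Δ : Type*} (a : ℕ → Δ) (q p : ℕ) : Prop :=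
  1 ≤ p ∧ p ≤ q ∧ ∃ i, ∀ j, j + p < q → a (i + j) = a (i + j + p)

/-! ### Powers, periods and bounds for c₂ -/

section Words

variable {Δ : Type*} {a : ℕ → Δ}

@[simp] lemma length_factorAt (i n : ℕ) : (factorAt a i n).length = n := by
  simp [factorAt]

lemma getElem_factorAt (i n j : ℕ) (h : j < (factorAt a i n).length) :
    (factorAt a i n)[j] = a (i + j) := by
  simp [factorAt]

lemma hasPeriod_factorAt_iff (i q p : ℕ) :
    (factorAt a i q).HasPeriod p ↔ ∀ j, j + p < q → a (i + j) = a (i + j + p) := by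
  rw [List.hasPeriod_iff_getElem?, length_factorAt]
  refine forall_congr' fun j => ?_
  constructor
  · intro h hj
    have := h (by omega)
    rw [List.getElem?_eq_getElem (by simp; omega), List.getElem?_eq_getElem (by simp; omega),
      getElem_factorAt, getElem_factorAt, Option.some_inj] at this
    rw [this, add_assoc]
  · intro h hj
    have := h (by omega)
    rw [List.getElem?_eq_getElem (by simp; omega), List.getElem?_eq_getElem (by simp; omega),
      getElem_factorAt, getElem_factorAt, this, add_assoc]

lemma periodLang_eq (k : ℕ) [NeZero k] :
    periodLang k a = {x | ∃ q p, HasRepetition a q p ∧ x = pairWord k q p} := by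
  ext x
  constructor
  · rintro ⟨w, p, ⟨i, hi⟩, h1, h2, h3, rfl⟩
    refine ⟨w.length, p, ⟨h1, h2, i, ?_⟩, rfl⟩
    rw [← hi] at h3
    exact (hasPeriod_factorAt_iff _ _ _).1 h3
  · rintro ⟨q, p, ⟨h1, h2, i, h3⟩, rfl⟩
    exact ⟨factorAt a i q, p, ⟨i, by simp⟩, h1, by simpa using h2,
      (hasPeriod_factorAt_iff _ _ _).2 h3, by simp⟩

lemma getElem?_flatten_replicate (w : List Δ) (n j : ℕ) (hj : j < n * w.length) :
    (List.replicate n w).flatten[j]? = w[j % w.length]? := by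
  induction n generalizing j with
  | zero => simp at hj
  | succ n ih =>
    rw [List.replicate_succ, List.flatten_cons]
    by_cases h : j < w.length
    · rw [List.getElem?_append_left h, Nat.mod_eq_of_lt h]
    · push Not at h
      rw [List.getElem?_append_right h, ih _ (by rw [Nat.succ_mul] at hj; omega),
        ← Nat.mod_eq_sub_mod h]

lemma ceil_mul_length_le (w : List Δ) (β : ℝ) :
    ⌈β * (w.length : ℝ)⌉₊ ≤ ⌈β⌉₊ * w.length := by
  rw [Nat.ceil_le]
  push_cast
  exact mul_le_mul_of_nonneg_right (Nat.le_ceil β) (Nat.cast_nonneg _)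

lemma length_wordPow (w : List Δ) (β : ℝ) :
    (wordPow w β).length = ⌈β * (w.length : ℝ)⌉₊ := by
  simpa [wordPow] using ceil_mul_length_le w β

lemma getElem?_wordPow (w : List Δ) (β : ℝ) {j : ℕ} (hj : j < ⌈β * (w.length : ℝ)⌉₊) :
    (wordPow w β)[j]? = w[j % w.length]? := by
  rw [wordPow, List.getElem?_take_of_lt hj,
    getElem?_flatten_replicate _ _ _ (hj.trans_le (ceil_mul_length_le w β))]

/-- The powers `w ^ β` occurring in `a`, in terms of lengths and periods of factors. -/
lemma exists_wordPow_iff {β : ℝ} (hβ : 1 ≤ β) {N : ℕ} (hN : 1 ≤ N) :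
    (∃ w : List Δ, N ≤ w.length ∧ IsFactor (wordPow w β) a) ↔
      ∃ q p : ℕ, N ≤ p ∧ β * p ≤ q ∧ HasRepetition a q p := by
  constructor
  · rintro ⟨w, hw, i, hi⟩
    rw [length_wordPow] at hi
    have hle : w.length ≤ ⌈β * (w.length : ℝ)⌉₊ := by
      have : (w.length : ℝ) ≤ β * w.length := le_mul_of_one_le_left (Nat.cast_nonneg _) hβ
      exact_mod_cast this.trans (Nat.le_ceil _)
    refine ⟨⌈β * (w.length : ℝ)⌉₊, w.length, hw, Nat.le_ceil _, by omega, hle, i, fun j hj => ?_⟩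
    have key : ∀ j, j < ⌈β * (w.length : ℝ)⌉₊ → some (a (i + j)) = w[j % w.length]? := by
      intro j hj
      rw [← getElem?_wordPow w β hj, ← hi, List.getElem?_eq_getElem (by simpa using hj),
        getElem_factorAt]
    have h1 := key j (by omega)
    have h2 := key _ hj
    rw [Nat.add_mod_right, ← h1, Option.some_inj, ← add_assoc] at h2
    exact h2.symm
  · rintro ⟨q, p, hp, hq, h1, h2, i, h3⟩
    refine ⟨factorAt a i p, by simpa using hp, i, ?_⟩
    have hmod : ∀ j, j < q → a (i + j) = a (i + j % p) := by
      intro j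
      induction j using Nat.strong_induction_on with
      | _ j ih =>
        intro hj
        by_cases hjp : j < p
        · rw [Nat.mod_eq_of_lt hjp]
        · have := h3 (j - p) (by omega)
          rw [show i + (j - p) + p = i + j by omega] at this
          rw [← this, ih (j - p) (by omega) (by omega), ← Nat.mod_eq_sub_mod (by omega)]
    have hc : ⌈β * (p : ℝ)⌉₊ ≤ q := Nat.ceil_le.2 hq
    apply List.ext_getElem?
    intro j
    by_cases hj : j < ⌈β * (p : ℝ)⌉₊
    · rw [getElem?_wordPow _ _ (by simpa using hj), List.getElem?_eq_getElem
        (by simpa [length_wordPow] using hj), getElem_factorAt, length_factorAt,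
        List.getElem?_eq_getElem (by simpa using Nat.mod_lt _ (by omega)), getElem_factorAt,
        hmod j (by omega)]
    · rw [List.getElem?_eq_none (by simpa [length_wordPow] using hj),
        List.getElem?_eq_none (by simpa [length_wordPow] using hj)]

lemma c₂_eq : c₂ a = sSup {b : EReal | ∃ β : ℝ, b = (β : EReal) ∧ 1 ≤ β ∧
    ∀ N : ℕ, 1 ≤ N → ∃ q p : ℕ, N ≤ p ∧ β * p ≤ q ∧ HasRepetition a q p} := by
  unfold c₂
  congr 1
  ext b
  refine exists_congr fun β => and_congr_right fun _ => and_congr_right fun hβ =>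
    forall_congr' fun N => forall_congr' fun hN => exists_wordPow_iff hβ hN

lemma hasRepetition_self {p : ℕ} (hp : 1 ≤ p) : HasRepetition a p p :=
  ⟨hp, le_rfl, 0, fun j hj => by omega⟩

lemma HasRepetition.mul {q p m : ℕ} (h : HasRepetition a q p) (hm : 1 ≤ m) (hq : m * p ≤ q) :
    HasRepetition a q (m * p) := by
  obtain ⟨h1, h2, i, h3⟩ := h
  refine ⟨Nat.mul_pos hm h1, hq, i, ?_⟩
  clear hq
  induction m, hm using Nat.le_induction with
  | base => simpa using h3
  | succ m _ ih =>
    intro j hj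
    rw [Nat.succ_mul] at hj ⊢
    rw [ih j (by omega), ← add_assoc, add_assoc i, h3 (j + m * p) (by omega)]

lemma le_c₂ {β : ℝ} (hβ : 1 ≤ β)
    (h : ∀ N : ℕ, ∃ q p : ℕ, N ≤ p ∧ β * p ≤ q ∧ HasRepetition a q p) : (β : EReal) ≤ c₂ a := by
  rw [c₂_eq]
  exact le_sSup ⟨β, rfl, hβ, fun N _ => h N⟩

lemma one_le_c₂ : 1 ≤ c₂ a := by
  have := le_c₂ (a := a) (β := 1) le_rfl fun N => ⟨N + 1, N + 1, by omega, by simp,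
    hasRepetition_self (by omega)⟩
  simpa using this

/-- Arbitrarily long factors with one fixed period. -/
lemma c₂_eq_top {p : ℕ} (h : ∀ n, ∃ q, n ≤ q ∧ HasRepetition a q p) : c₂ a = ⊤ := by
  rw [EReal.eq_top_iff_forall_lt]
  intro y
  refine lt_of_lt_of_le (b := ((max 1 (y + 1) : ℝ) : EReal)) ?_ (le_c₂ (le_max_left _ _) ?_)
  · exact_mod_cast lt_of_lt_of_le (lt_add_one y) (le_max_right _ _)
  · intro N
    -- c₂ requires long periods, so p is replaced by its multiple (N + 1)p, again a period.
    obtain ⟨q, hq, hr⟩ := h (⌈(max 1 (y + 1)) * (((N + 1) * p : ℕ) : ℝ)⌉₊ + (N + 1) * p)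
    refine ⟨q, (N + 1) * p, ?_, ?_, hr.mul (by omega) (by omega)⟩
    · nlinarith [hr.1]
    · refine (Nat.le_ceil _).trans ?_
      exact_mod_cast (Nat.le_add_right _ _).trans hq

/-- A linear upper bound on the lengths of the repetitions bounds `c₂`. -/
lemma c₂_le {A B C : ℕ} (hB : 0 < B) (h : ∀ q p, HasRepetition a q p → q * B ≤ A * p + C) :
    c₂ a ≤ (((A : ℝ) / B : ℝ) : EReal) := by
  rw [c₂_eq]
  refine sSup_le ?_
  rintro _ ⟨β, rfl, -, hβ⟩
  rw [EReal.coe_le_coe_iff]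
  have hB' : (0 : ℝ) < B := by exact_mod_cast hB
  rw [le_div_iff₀ hB']
  by_contra! hlt
  obtain ⟨N, hN⟩ := exists_nat_gt ((C : ℝ) / (β * B - A))
  obtain ⟨q, p, hp, hq, hr⟩ := hβ (N + 1) (by omega)
  rw [div_lt_iff₀ (by linarith)] at hN
  have h1 : (q : ℝ) * B ≤ A * p + C := by exact_mod_cast h q p hr
  have h2 : (N : ℝ) + 1 ≤ p := by exact_mod_cast hp
  nlinarith

/-- For γ below D₁/D₂ the gap (D₁ - γD₂)P eventually absorbs the constant C. -/
lemma le_c₂_of_const {D₁ D₂ : ℕ} (hD : 0 < D₂) {Q P : ℕ → ℕ} {C : ℤ}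
    (hS : ∀ m, HasRepetition a (Q m) (P m)) (hP : StrictMono P)
    (hC : ∀ m, (D₂ : ℤ) * Q m - D₁ * P m = C) : (((D₁ : ℝ) / D₂ : ℝ) : EReal) ≤ c₂ a := by
  have hD' : (0 : ℝ) < D₂ := by exact_mod_cast hD
  refine EReal.ge_of_forall_gt_iff_ge.1 fun γ hγ => ?_
  rw [EReal.coe_lt_coe_iff] at hγ
  rcases lt_or_ge γ 1 with h1 | h1
  · exact le_trans (by exact_mod_cast h1.le) one_le_c₂
  refine le_c₂ h1 fun N => ?_
  rw [lt_div_iff₀ hD'] at hγ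
  obtain ⟨m, hm⟩ := exists_nat_gt (-(C : ℝ) / (D₁ - γ * D₂))
  rw [div_lt_iff₀ (by linarith)] at hm
  refine ⟨Q (max m N), P (max m N), (le_max_right m N).trans (hP.id_le _), ?_, hS _⟩
  have h2 : (m : ℝ) ≤ P (max m N) := by exact_mod_cast (le_max_left m N).trans (hP.id_le _)
  have h3 : (D₂ : ℝ) * Q (max m N) - D₁ * P (max m N) = C := by exact_mod_cast hC (max m N)
  have h4 : (m : ℝ) * (D₁ - γ * D₂) ≤ P (max m N) * (D₁ - γ * D₂) :=
    mul_le_mul_of_nonneg_right h2 (by linarith)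
  have h5 : (γ * P (max m N)) * D₂ ≤ Q (max m N) * D₂ := by nlinarith
  exact le_of_mul_le_mul_right h5 hD'

end Words

/-! ### Encoded pairs and special points -/

section Encoding

variable {k : ℕ} [NeZero k]

lemma wordVal_leftpad_natWord (hk : 2 ≤ k) (m len : ℕ) :
    wordVal ((natWord k m).leftpad len 0) = m := by
  have h : (Nat.digits k m).map (Fin.val ∘ Fin.ofNat k) = Nat.digits k m := by
    conv_rhs => rw [← List.map_id (Nat.digits k m)]
    refine List.map_congr_left fun d hd => ?_
    simpa using Nat.mod_eq_of_lt (Nat.digits_lt_base (by omega) hd)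
  simp [wordVal, natWord, List.leftpad, Nat.ofDigits_append, h, Nat.ofDigits_digits]

lemma wordVal_fst_pairWord (hk : 2 ≤ k) (m n : ℕ) :
    wordVal ((pairWord k m n).map Prod.fst) = m := by
  rw [pairWord, List.map_fst_zip (by simp [List.leftpad]), wordVal_leftpad_natWord hk]

lemma wordVal_snd_pairWord (hk : 2 ≤ k) (m n : ℕ) :
    wordVal ((pairWord k m n).map Prod.snd) = n := by
  rw [pairWord, List.map_snd_zip (by simp [List.leftpad]), wordVal_leftpad_natWord hk]

lemma quo_pairWord (hk : 2 ≤ k) (m n : ℕ) : quo (pairWord k m n) = (m : ℚ) / n := by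
  rw [quo, wordVal_fst_pairWord hk, wordVal_snd_pairWord hk]

lemma coe_quo_pairWord (hk : 2 ≤ k) (m n : ℕ) :
    (((quo (pairWord k m n) : ℚ) : ℝ) : EReal) = (((m : ℝ) / n : ℝ) : EReal) := by
  rw [quo_pairWord hk]
  push_cast
  rfl

lemma pairWord_inj (hk : 2 ≤ k) {m n m' n' : ℕ} (h : pairWord k m n = pairWord k m' n') :
    m = m' ∧ n = n' :=
  ⟨by rw [← wordVal_fst_pairWord hk m n, h, wordVal_fst_pairWord hk],
    by rw [← wordVal_snd_pairWord hk m n, h, wordVal_snd_pairWord hk]⟩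

variable {Δ : Type*} {a : ℕ → Δ}

lemma isSpecialPoint_of_tendsto (hk : 2 ≤ k) {Q P : ℕ → ℕ} {β : EReal}
    (hS : ∀ m, HasRepetition a (Q m) (P m)) (hQ : StrictMono Q)
    (h : Tendsto (fun m => (((Q m : ℝ) / P m : ℝ) : EReal)) atTop (𝓝 β)) :
    IsSpecialPoint (periodLang k a) β := by
  refine ⟨fun m => pairWord k (Q m) (P m), fun m m' hm => hQ.injective (pairWord_inj hk hm).1,
    fun m => ?_, ?_⟩
  · rw [periodLang_eq]
    exact ⟨_, _, hS m, rfl⟩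
  · simpa only [coe_quo_pairWord hk] using h

lemma isSpecialPoint_of_const (hk : 2 ≤ k) {D₁ D₂ : ℕ} (hD : 0 < D₂) {Q P : ℕ → ℕ} {C : ℤ}
    (hS : ∀ m, HasRepetition a (Q m) (P m)) (hQ : StrictMono Q) (hP : StrictMono P)
    (hC : ∀ m, (D₂ : ℤ) * Q m - D₁ * P m = C) :
    IsSpecialPoint (periodLang k a) (((D₁ : ℝ) / D₂ : ℝ) : EReal) := by
  refine isSpecialPoint_of_tendsto hk hS hQ ((continuous_coe_real_ereal.tendsto _).comp ?_)
  have h1 : Tendsto (fun m => (P m : ℝ)) atTop atTop :=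
    tendsto_natCast_atTop_atTop.comp hP.tendsto_atTop
  have h2 := (h1.const_div_atTop ((C : ℝ) / D₂)).const_add ((D₁ : ℝ) / D₂)
  rw [add_zero] at h2
  refine h2.congr fun m => ?_
  have h3 : (D₂ : ℝ) * Q m - D₁ * P m = C := by exact_mod_cast hC m
  have h4 : (P m : ℝ) ≠ 0 := by exact_mod_cast Nat.one_le_iff_ne_zero.1 (hS m).1
  have h5 : (D₂ : ℝ) ≠ 0 := by exact_mod_cast hD.ne'
  rw [← h3]
  field_simp
  ring

lemma isSpecialPoint_top (hk : 2 ≤ k) {Q : ℕ → ℕ} {p : ℕ}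
    (hS : ∀ m, HasRepetition a (Q m) p) (hQ : StrictMono Q) :
    IsSpecialPoint (periodLang k a) ⊤ := by
  refine isSpecialPoint_of_tendsto (P := fun _ => p) hk hS hQ (EReal.tendsto_coe_atTop.comp ?_)
  refine Tendsto.atTop_div_const ?_ (tendsto_natCast_atTop_atTop.comp hQ.tendsto_atTop)
  exact_mod_cast (hS 0).1

/-- A linear upper bound on the lengths of the repetitions bounds the special points. -/
lemma IsSpecialPoint.le (hk : 2 ≤ k) {A B C : ℕ} (hB : 0 < B)
    (h : ∀ q p, HasRepetition a q p → q * B ≤ A * p + C) {β : EReal}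
    (hβ : IsSpecialPoint (periodLang k a) β) : β ≤ (((A : ℝ) / B : ℝ) : EReal) := by
  obtain ⟨x, hx, hL, hlim⟩ := hβ
  rw [periodLang_eq] at hL
  choose Q P hS hxe using hL
  obtain rfl : x = fun j => pairWord k (Q j) (P j) := funext hxe
  simp only [coe_quo_pairWord hk] at hlim
  -- Bounded P would force bounded Q by `h`, leaving finitely many pairs for infinitely many
  -- distinct words.
  have hP : Tendsto P atTop atTop := by
    rw [tendsto_atTop]
    intro b
    rw [← Nat.cofinite_eq_atTop, Filter.eventually_cofinite]
    refine Set.Finite.of_finite_image (f := fun j => (Q j, P j))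
      (((Set.finite_Iic (A * b + C)).prod (Set.finite_Iic b)).subset ?_) ?_
    · rintro _ ⟨j, hj, rfl⟩
      simp only [Set.mem_ofPred_eq, not_le] at hj
      refine ⟨?_, hj.le⟩
      have h1 := h _ _ (hS j)
      have h2 : Q j ≤ Q j * B := Nat.le_mul_of_pos_right _ hB
      have h3 : A * P j ≤ A * b := Nat.mul_le_mul_left _ hj.le
      simp only [Set.mem_Iic]
      omega
    · intro i _ j _ hij
      simp only [Prod.mk.injEq] at hij
      exact hx (by simp [hij.1, hij.2])
  have h1 : Tendsto (fun m => (P m : ℝ)) atTop atTop := tendsto_natCast_atTop_atTop.comp hP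
  have h2 := (h1.const_div_atTop ((C : ℝ) / B)).const_add ((A : ℝ) / B)
  rw [add_zero] at h2
  refine le_of_tendsto_of_tendsto' hlim ((continuous_coe_real_ereal.tendsto _).comp h2)
    fun j => EReal.coe_le_coe_iff.2 ?_
  have h3 : (Q j : ℝ) * B ≤ A * P j + C := by exact_mod_cast h _ _ (hS j)
  have h4 : (0 : ℝ) < P j := by exact_mod_cast (hS j).1
  have h5 : (0 : ℝ) < B := by exact_mod_cast hB
  rw [div_le_iff₀ h4]
  have h6 : ((A : ℝ) / B + C / B / P j) * P j = (A * P j + C) / B := by field_simp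
  rw [h6, le_div_iff₀ h5]
  exact h3

end Encoding

/-! ### State maps, projection and bounded witnesses -/

section StateMaps

variable {ι σ : Type*} {k : ℕ}

/-- The values of `φ` behave like the states of an automaton reading base-`k` digits, most
significant digit first: appending a digit to every coordinate respects equality of states. -/
def DigitCongr (k : ℕ) (φ : (ι → ℕ) → σ) : Prop :=
  ∀ v w r : ι → ℕ, (∀ i, r i < k) → φ v = φ w →
    φ (fun i => k * v i + r i) = φ (fun i => k * w i + r i)

lemma DigitCongr.pow {φ : (ι → ℕ) → σ} (h : DigitCongr k φ) (e : ℕ) : DigitCongr (k ^ e) φ := by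
  induction e with
  | zero =>
    intro v w r hr hvw
    have : r = 0 := funext fun i => by simpa using hr i
    simpa [this] using hvw
  | succ e ih =>
    intro v w r hr hvw
    rcases Nat.eq_zero_or_pos k with rfl | hk
    · obtain hι | ⟨⟨i⟩⟩ := isEmpty_or_nonempty ι
      · exact congrArg φ (Subsingleton.elim _ _)
      · exact absurd (hr i) (by simp)
    have h1 := h _ _ (fun i => r i % k) (fun i => Nat.mod_lt _ hk)
      (ih v w (fun i => r i / k) (fun i => by
        rw [Nat.div_lt_iff_lt_mul hk, ← pow_succ]
        exact hr i) hvw)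
    have h2 : ∀ u : ι → ℕ, (fun i => k * (k ^ e * u i + r i / k) + r i % k) =
        fun i => k ^ (e + 1) * u i + r i := fun u => funext fun i => by
      rw [mul_add, add_assoc, Nat.div_add_mod, pow_succ]
      ring
    rwa [h2, h2] at h1

variable [DecidableEq ι]

/-- The set of states that are reached when the coordinate `j` is varied. -/
def projState (j : ι) (φ : (ι → ℕ) → σ) (v : ι → ℕ) : Set σ :=
  Set.range fun u => φ (Function.update v j u)

/-- This is the subset construction: the last digit of u is split off, and the rest of u is traded
for a value giving the same state. A u longer than the other coordinates merely meets their leading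
zeros. -/
lemma DigitCongr.projState {φ : (ι → ℕ) → σ} (h : DigitCongr k φ) (hk : 0 < k) (j : ι) :
    DigitCongr k (projState j φ) := by
  have key : ∀ v w r : ι → ℕ, (∀ i, r i < k) → AutSeq.projState j φ v = AutSeq.projState j φ w →
      AutSeq.projState j φ (fun i => k * v i + r i) ⊆
        AutSeq.projState j φ (fun i => k * w i + r i) := by
    rintro v w r hr hvw _ ⟨u, rfl⟩
    obtain ⟨u', hu'⟩ : φ (Function.update v j (u / k)) ∈ AutSeq.projState j φ w :=
      hvw ▸ ⟨u / k, rfl⟩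
    refine ⟨k * u' + u % k, ?_⟩
    have h1 := h _ _ (Function.update r j (u % k)) (fun i => by
      by_cases hi : i = j
      · subst hi
        simpa using Nat.mod_lt _ hk
      · simpa [hi] using hr i) hu'
    have h2 : ∀ (x : ι → ℕ) (y z : ℕ), (fun i => k * Function.update x j y i +
        Function.update r j z i) = Function.update (fun i => k * x i + r i) j (k * y + z) := by
      intro x y z
      ext i
      by_cases hi : i = j
      · subst hi
        simp
      · simp [hi]
    rw [h2, h2, Nat.div_add_mod] at h1
    exact h1
  intro v w r hr hvw
  exact Set.Subset.antisymm (key v w r hr hvw) (key w v r hr hvw.symm)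

lemma exists_lt_map_eq [Finite σ] {N : ℕ} (hN : Nat.card σ ≤ N) (f : ℕ → σ) :
    ∃ s t, s < t ∧ t ≤ N ∧ f s = f t := by
  have := Fintype.ofFinite σ
  rw [Nat.card_eq_fintype_card] at hN
  obtain ⟨s, t, hst, h⟩ := Fintype.exists_ne_map_eq_of_card_lt (fun i : Fin (N + 1) => f i)
    (by simpa using Nat.lt_succ_of_le hN)
  rcases lt_or_gt_of_ne hst with h1 | h1
  · exact ⟨s, t, h1, Nat.le_of_lt_succ t.2, h⟩
  · exact ⟨t, s, h1, Nat.le_of_lt_succ s.2, h.symm⟩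

/-- Every state that can be reached by varying one coordinate is reached with a value of that
coordinate that is bounded in terms of the other coordinates. -/
lemma DigitCongr.exists_lt_update [Finite σ] {φ : (ι → ℕ) → σ} (h : DigitCongr k φ) (hk : 1 < k)
    {N : ℕ} (hN : Nat.card σ ≤ N) (j : ι) {m : ℕ} (v : ι → ℕ) (hv : ∀ i, i ≠ j → v i < k ^ m)
    (u : ℕ) : ∃ u' < k ^ (m + N), φ (Function.update v j u') = φ (Function.update v j u) := by
  induction u using Nat.strong_induction_on with
  | _ u ih =>
    by_cases hu : u < k ^ (m + N)
    · exact ⟨u, hu, rfl⟩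
    push Not at hu
    have hk0 : 0 < k := by omega
    -- Above the last m digits of u all other coordinates are zero, so only u drives the state
    -- there; the digits between two equal states are cut out.
    obtain ⟨s, t, hst, htN, heq⟩ := exists_lt_map_eq hN
      fun t => φ (Function.update 0 j (u / k ^ (m + t)))
    have hpos : ∀ e, 0 < k ^ e := fun e => Nat.pow_pos hk0
    have h1 := h.pow (m + s) _ _ (Function.update v j (u % k ^ (m + s))) (fun i => by
      by_cases hi : i = j
      · subst hi
        simpa using Nat.mod_lt _ (hpos _)
      · simpa [hi] using (hv i hi).trans_le (Nat.pow_le_pow_right hk0 (Nat.le_add_right _ _))) heq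
    have h2 : ∀ y z : ℕ, (fun i => k ^ (m + s) * Function.update (0 : ι → ℕ) j y i +
        Function.update v j z i) = Function.update v j (k ^ (m + s) * y + z) := by
      intro y z
      ext i
      by_cases hi : i = j
      · subst hi
        simp
      · simp [hi]
    rw [h2, h2, Nat.div_add_mod] at h1
    have h3 : u / k ^ (m + t) < u / k ^ (m + s) := by
      have h4 : u / k ^ (m + t) = u / k ^ (m + s) / k ^ (t - s) := by
        rw [Nat.div_div_eq_div_mul, ← pow_add]
        congr 2
        omega
      rw [h4]
      refine Nat.div_lt_self (Nat.div_pos ?_ (hpos _)) (Nat.one_lt_pow (by omega) hk)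
      exact (Nat.pow_le_pow_right hk0 (by omega)).trans hu
    obtain ⟨u', hu', hu''⟩ := ih (k ^ (m + s) * (u / k ^ (m + t)) + u % k ^ (m + s)) (by
      conv_rhs => rw [← Nat.div_add_mod u (k ^ (m + s))]
      have := Nat.mul_lt_mul_of_pos_left h3 (hpos (m + s))
      omega)
    exact ⟨u', hu', hu''.trans h1.symm⟩

end StateMaps

/-! ### Pumping and slopes -/

section Lassos

/-- The number obtained from `x` by appending `m` copies of the digit block `y`, for blocks
in base `K`. -/
def pump (K y x m : ℕ) : ℕ :=
  Nat.rec x (fun _ v => K * v + y) m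

@[simp] lemma pump_zero (K y x : ℕ) : pump K y x 0 = x := rfl

lemma pump_succ (K y x m : ℕ) : pump K y x (m + 1) = K * pump K y x m + y := rfl

/-- The factor K ^ m does not depend on the coordinate, so pumping a pair moves it along the fixed
direction (D₁, D₂). -/
lemma pump_succ' {K y x D : ℕ} (h : D + x = K * x + y) (m : ℕ) :
    pump K y x (m + 1) = pump K y x m + K ^ m * D := by
  induction m with
  | zero => rw [pump_succ, pump_zero, ← h]; ring
  | succ m ih => rw [pump_succ, ih, mul_add, pow_succ, add_right_comm, ← pump_succ, ih]; ring

/-- The block `(y₁, y₂)` of `e` digits, read after the prefix `(x₁, x₂)` and followed by the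
suffix `(z₁, z₂)` of `f` digits, can be repeated up to `N` times within `S`; and `(D₁, D₂)` is the
difference of the pairs represented by the prefix with and without the block. -/
structure IsLasso (k N : ℕ) (S : ℕ → ℕ → Prop) (D₁ D₂ x₁ x₂ e y₁ y₂ f z₁ z₂ : ℕ) : Prop where
  pos : 0 < D₁
  hy₁ : y₁ < k ^ e
  hy₂ : y₂ < k ^ e
  hz₁ : z₁ < k ^ f
  hz₂ : z₂ < k ^ f
  hD₁ : D₁ + x₁ = k ^ e * x₁ + y₁
  hD₂ : D₂ + x₂ = k ^ e * x₂ + y₂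
  mem : ∀ m < N + 1, S (k ^ f * pump (k ^ e) y₁ x₁ m + z₁) (k ^ f * pump (k ^ e) y₂ x₂ m + z₂)

/-- The quotient `D₁ / D₂` is the limit along a lasso all of whose parts are less than `b`. -/
def IsSlope (k N b : ℕ) (S : ℕ → ℕ → Prop) (D₁ D₂ : ℕ) : Prop :=
  ∃ x₁ < b, ∃ x₂ < b, ∃ e < b, ∃ y₁ < b, ∃ y₂ < b, ∃ f < b, ∃ z₁ < b, ∃ z₂ < b,
    IsLasso k N S D₁ D₂ x₁ x₂ e y₁ y₂ f z₁ z₂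

variable {k N : ℕ} {σ : Type*} [Finite σ] {χ : ℕ → ℕ → σ} {S : ℕ → ℕ → Prop}

/-- `χ` is the state map of an automaton with at most `N` states that recognizes `S`, reading
base-`k` digits with the most significant digit first. -/
structure Recognizes (k N : ℕ) {σ : Type*} (χ : ℕ → ℕ → σ) (S : ℕ → ℕ → Prop) : Prop where
  card : Nat.card σ ≤ N
  append : ∀ {e q p q' p' r s : ℕ}, r < k ^ e → s < k ^ e → χ q p = χ q' p' →
    χ (k ^ e * q + r) (k ^ e * p + s) = χ (k ^ e * q' + r) (k ^ e * p' + s)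
  mem : ∀ {q p q' p' : ℕ}, χ q p = χ q' p' → S q p → S q' p'

/-- The finitely many repetitions tested in `IsLasso` suffice: two of them reach the same state, and
from there on the states are periodic. -/
lemma IsLasso.exists_seq {D₁ D₂ x₁ x₂ e y₁ y₂ f z₁ z₂ : ℕ} (hχ : Recognizes k N χ S) (hk : 0 < k)
    (h : IsLasso k N S D₁ D₂ x₁ x₂ e y₁ y₂ f z₁ z₂) :
    ∃ Q P : ℕ → ℕ, (∀ m, S (Q m) (P m)) ∧ StrictMono Q ∧ (0 < D₂ → StrictMono P) ∧
      (D₂ = 0 → ∀ m, P m = P 0) ∧ ∃ C : ℤ, ∀ m, (D₂ : ℤ) * Q m - D₁ * P m = C := by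
  obtain ⟨s, t, hst, htN, heq⟩ := exists_lt_map_eq hχ.card
    fun m => χ (pump (k ^ e) y₁ x₁ m) (pump (k ^ e) y₂ x₂ m)
  have hshift : ∀ m, χ (pump (k ^ e) y₁ x₁ (s + m)) (pump (k ^ e) y₂ x₂ (s + m)) =
      χ (pump (k ^ e) y₁ x₁ (t + m)) (pump (k ^ e) y₂ x₂ (t + m)) := by
    intro m
    induction m with
    | zero => exact heq
    | succ m ih => exact hχ.append h.hy₁ h.hy₂ ih
  have hmem : ∀ m, S (k ^ f * pump (k ^ e) y₁ x₁ m + z₁) (k ^ f * pump (k ^ e) y₂ x₂ m + z₂) := by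
    intro m
    induction m using Nat.strong_induction_on with
    | _ m ih =>
      by_cases hm : m < N + 1
      · exact h.mem m hm
      · refine hχ.mem ?_ (ih (s + (m - t)) (by omega))
        refine hχ.append h.hz₁ h.hz₂ ((hshift _).trans ?_)
        rw [show t + (m - t) = m by omega]
  have hstep₁ := pump_succ' h.hD₁
  have hstep₂ := pump_succ' h.hD₂
  have hke : ∀ m, 0 < (k ^ e) ^ m := fun m => by positivity
  have hkf : 0 < k ^ f := by positivity
  refine ⟨_, _, hmem, strictMono_nat_of_lt_succ fun m => ?_,
    fun hD => strictMono_nat_of_lt_succ fun m => ?_, fun hD m => ?_,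
    (D₂ : ℤ) * (k ^ f * x₁ + z₁ : ℕ) - D₁ * (k ^ f * x₂ + z₂ : ℕ), fun m => ?_⟩
  · rw [hstep₁]
    have := Nat.mul_pos hkf (Nat.mul_pos (hke m) h.pos)
    rw [mul_add]
    omega
  · rw [hstep₂]
    have := Nat.mul_pos hkf (Nat.mul_pos (hke m) hD)
    rw [mul_add]
    omega
  · induction m with
    | zero => rfl
    | succ m ih => rwa [hstep₂, hD, mul_zero, add_zero]
  · induction m with
    | zero => rfl
    | succ m ih =>
      rw [← ih, hstep₁, hstep₂]
      push_cast
      ring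

lemma div_pow_eq {k : ℕ} (x : ℕ) {s t : ℕ} (h : s ≤ t) :
    x / k ^ s = k ^ (t - s) * (x / k ^ t) + x / k ^ s % k ^ (t - s) := by
  have h1 : x / k ^ t = x / k ^ s / k ^ (t - s) := by
    rw [Nat.div_div_eq_div_mul, ← pow_add]
    congr 2
    omega
  rw [h1, Nat.div_add_mod]

/-- A state from which `S` can be reached allows to reach it within `N` digits. -/
lemma Recognizes.exists_suffix (hχ : Recognizes k N χ S) (hk : 0 < k) {x y : ℕ} (t : ℕ) :
    ∀ r s : ℕ, r < k ^ t → s < k ^ t → S (k ^ t * x + r) (k ^ t * y + s) →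
      ∃ f ≤ N, ∃ z₁ < k ^ f, ∃ z₂ < k ^ f, S (k ^ f * x + z₁) (k ^ f * y + z₂) := by
  induction t using Nat.strong_induction_on with
  | _ t ih =>
    intro r s hr hs hS
    by_cases ht : t ≤ N
    · exact ⟨t, ht, r, hr, s, hs, hS⟩
    push Not at ht
    have hpos : ∀ e, 0 < k ^ e := fun e => Nat.pow_pos hk
    -- The suffix is longer than N, so a state repeats after m < n of its digits; digits m + 1 to n
    -- are dropped.
    obtain ⟨m, n, hmn, hnN, heq⟩ := exists_lt_map_eq hχ.card
      fun m => χ ((k ^ t * x + r) / k ^ (t - m)) ((k ^ t * y + s) / k ^ (t - m))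
    have hprefix : ∀ x r, (k ^ t * x + r) / k ^ (t - m) = k ^ m * x + r / k ^ (t - m) := by
      intro x r
      have : k ^ t = k ^ (t - m) * k ^ m := by rw [← pow_add]; congr 1; omega
      rw [this, mul_assoc, Nat.mul_add_div (hpos _)]
    have hlt : ∀ x r, r < k ^ t →
        k ^ (t - n) * (r / k ^ (t - m)) + (k ^ t * x + r) % k ^ (t - n) < k ^ (t - n + m) := by
      intro x r hr
      have h1 : r / k ^ (t - m) < k ^ m := by
        rw [Nat.div_lt_iff_lt_mul (hpos _), ← pow_add, Nat.add_sub_cancel' (by omega)]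
        exact hr
      have h2 := Nat.mod_lt (k ^ t * x + r) (hpos (t - n))
      rw [pow_add]
      have h3 := Nat.mul_le_mul_left (k ^ (t - n)) (Nat.succ_le_of_lt h1)
      rw [Nat.mul_succ] at h3
      omega
    refine ih (t - n + m) (by omega) _ _ (hlt x r hr) (hlt y s hs) ?_
    have h1 := hχ.append (e := t - n) (Nat.mod_lt (k ^ t * x + r) (hpos _))
      (Nat.mod_lt (k ^ t * y + s) (hpos _)) heq.symm
    simp only [Nat.div_add_mod] at h1
    have h2 := hχ.mem h1 hS
    rwa [hprefix, hprefix, mul_add, mul_add, ← mul_assoc, ← mul_assoc, ← pow_add, add_assoc,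
      add_assoc] at h2

/-- Cutting a block out of the first digits of an element of `S`. -/
lemma Recognizes.exists_isSlope (hχ : Recognizes k N χ S) (hk : 1 < k)
    (hle : ∀ q p, S q p → p ≤ q) {q p : ℕ} (hS : S q p) (hq : k ^ N ≤ q) :
    ∃ D₁ < k ^ N + N + 1, ∃ D₂ < k ^ N + N + 1, IsSlope k N (k ^ N + N + 1) S D₁ D₂ ∧
      ∃ q' p' c, S q' p' ∧ 0 < c ∧ q = q' + c * D₁ ∧ p = p' + c * D₂ := by
  have hk0 : 0 < k := by omega
  have hpos : ∀ e, 0 < k ^ e := fun e => Nat.pow_pos hk0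
  -- q has l + 1 digits, and p ≤ q fits into the same length.
  obtain ⟨l, hl1, hl2⟩ : ∃ l, k ^ l ≤ q ∧ q < k ^ (l + 1) :=
    ⟨Nat.log k q, Nat.pow_log_le_self k (by have := hpos N; omega), Nat.lt_pow_succ_log_self hk q⟩
  have hNl : N < l + 1 := (Nat.pow_lt_pow_iff_right hk).1 (hq.trans_lt hl2)
  obtain ⟨m, n, hmn, hnN, heq⟩ := exists_lt_map_eq hχ.card
    fun m => χ (q / k ^ (l + 1 - m)) (p / k ^ (l + 1 - m))
  obtain ⟨s, hs⟩ : ∃ s, s = l + 1 - n := ⟨_, rfl⟩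
  obtain ⟨t, ht⟩ : ∃ t, t = l + 1 - m := ⟨_, rfl⟩
  simp only [← hs, ← ht] at heq
  have hst : s < t := by omega
  obtain ⟨K, hK⟩ : ∃ K, K = k ^ (t - s) := ⟨_, rfl⟩
  have hK0 : 0 < K := hK ▸ hpos _
  have hK2 : 2 * 1 ≤ K := hK ▸ Nat.one_lt_pow (by omega) hk
  have hX₁ := div_pow_eq (k := k) q hst.le
  have hX₂ := div_pow_eq (k := k) p hst.le
  rw [← hK] at hX₁ hX₂
  have hbound : ∀ x, x < k ^ (l + 1) → x / k ^ s < k ^ N := fun x hx => by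
    rw [Nat.div_lt_iff_lt_mul (hpos _), ← pow_add]
    exact hx.trans_le (Nat.pow_le_pow_right hk0 (by omega))
  have hY₁ := hbound q hl2
  have hY₂ := hbound p ((hle q p hS).trans_lt hl2)
  -- As n ≥ 1, this prefix contains the nonzero leading digit of q; hence D₁ > 0.
  have hYpos : 0 < q / k ^ s :=
    Nat.div_pos ((Nat.pow_le_pow_right hk0 (by omega)).trans hl1) (hpos _)
  have hmul : ∀ x, x ≤ K * x := fun x => Nat.le_mul_of_pos_left _ hK0
  have hm₁ := hmul (q / k ^ t)
  have hm₂ := hmul (p / k ^ t)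
  have hm₃ := Nat.mul_le_mul_right (q / k ^ t) hK2
  -- The actual suffix has unbounded length s; a short one keeps the lasso within the search bound.
  obtain ⟨f, hf, z₁, hz₁, z₂, hz₂, hSz⟩ := hχ.exists_suffix hk0 (x := q / k ^ s) (y := p / k ^ s)
    s (q % k ^ s) (p % k ^ s) (Nat.mod_lt _ (hpos _)) (Nat.mod_lt _ (hpos _))
    (by simpa only [Nat.div_add_mod] using hS)
  have hr₁ : q / k ^ s % K < K := Nat.mod_lt _ hK0
  have hr₂ : p / k ^ s % K < K := Nat.mod_lt _ hK0
  have hχm : ∀ j, χ (pump K (q / k ^ s % K) (q / k ^ t) j) (pump K (p / k ^ s % K) (p / k ^ t) j) =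
      χ (q / k ^ s) (p / k ^ s) := by
    intro j
    induction j with
    | zero => exact heq
    | succ j ih =>
      rw [pump_succ, pump_succ]
      have h1 := hχ.append (e := t - s) (hK ▸ hr₁) (hK ▸ hr₂) (ih.trans heq.symm)
      rw [← hK, ← hX₁, ← hX₂] at h1
      exact h1
  have hkf : k ^ f ≤ k ^ N := Nat.pow_le_pow_right hk0 hf
  refine ⟨q / k ^ s - q / k ^ t, by omega, p / k ^ s - p / k ^ t,
    (Nat.sub_le _ _).trans_lt (by omega), ⟨q / k ^ t, by omega, p / k ^ t, by omega, t - s, by omega, q / k ^ s % K, by omega,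
      p / k ^ s % K, by omega, f, by omega, z₁, by omega, z₂, by omega,
      ⟨by omega, hK ▸ hr₁, hK ▸ hr₂, hz₁, hz₂, by rw [← hK]; omega, by rw [← hK]; omega,
        fun j _ => ?_⟩⟩, k ^ s * (q / k ^ t) + q % k ^ s, k ^ s * (p / k ^ t) + p % k ^ s,
    k ^ s, ?_, hpos _, ?_, ?_⟩
  · rw [← hK]
    exact hχ.mem (hχ.append hz₁ hz₂ (hχm j).symm) hSz
  · refine hχ.mem ?_ hS
    have h1 := hχ.append (e := s) (Nat.mod_lt q (hpos _)) (Nat.mod_lt p (hpos _)) heq.symm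
    simpa only [Nat.div_add_mod] using h1
  · have h1 := Nat.div_add_mod q (k ^ s)
    have h2 : q / k ^ t ≤ q / k ^ s := by omega
    rw [Nat.mul_sub]
    have := Nat.mul_le_mul_left (k ^ s) h2
    omega
  · have h1 := Nat.div_add_mod p (k ^ s)
    have h2 : p / k ^ t ≤ p / k ^ s := by omega
    rw [Nat.mul_sub]
    have := Nat.mul_le_mul_left (k ^ s) h2
    omega

/-- Each cut removes c(D₁, D₂), which satisfies the homogeneous inequality, so the error does not
accumulate and only the case q < k ^ N contributes the constant. -/
lemma Recognizes.mul_le (hχ : Recognizes k N χ S) (hk : 1 < k)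
    (hle : ∀ q p, S q p → p ≤ q) {A B : ℕ}
    (hmax : ∀ D₁ < k ^ N + N + 1, ∀ D₂ < k ^ N + N + 1, IsSlope k N (k ^ N + N + 1) S D₁ D₂ →
      D₁ * B ≤ A * D₂) (q : ℕ) : ∀ p, S q p → q * B ≤ A * p + k ^ N * B := by
  induction q using Nat.strong_induction_on with
  | _ q ih =>
    intro p hS
    by_cases hq : q < k ^ N
    · exact (Nat.mul_le_mul_right B hq.le).trans (Nat.le_add_left _ _)
    obtain ⟨D₁, hD₁, D₂, hD₂, hD, q', p', c, hS', hc, rfl, rfl⟩ :=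
      hχ.exists_isSlope hk hle hS (not_lt.1 hq)
    have hpos : 0 < D₁ := by
      obtain ⟨_, -, _, -, _, -, _, -, _, -, _, -, _, -, _, -, h⟩ := hD
      exact h.pos
    have h1 := ih q' (by have := Nat.mul_pos hc hpos; omega) p' hS'
    have h2 := Nat.mul_le_mul_left c (hmax D₁ hD₁ D₂ hD₂ hD)
    calc (q' + c * D₁) * B = q' * B + c * (D₁ * B) := by ring
      _ ≤ (A * p' + k ^ N * B) + c * (A * D₂) := Nat.add_le_add h1 h2
      _ = A * (p' + c * D₂) + k ^ N * B := by ring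

end Lassos

/-! ### The largest slope is the value of c₂ -/

section SlopeValue

variable {k N : ℕ} {σ : Type*} [Finite σ] {χ : ℕ → ℕ → σ} {Δ : Type*} {a : ℕ → Δ}

/-- `(D₁, D₂)` is a slope with the largest quotient, and that quotient is finite. -/
def IsMaxSlope (k N b : ℕ) (S : ℕ → ℕ → Prop) (D₁ D₂ : ℕ) : Prop :=
  0 < D₂ ∧ IsSlope k N b S D₁ D₂ ∧
    ∀ E₁ < b, ∀ E₂ < b, IsSlope k N b S E₁ E₂ → E₁ * D₂ ≤ D₁ * E₂

lemma IsSlope.pos {b : ℕ} {S : ℕ → ℕ → Prop} {D₁ D₂ : ℕ} (h : IsSlope k N b S D₁ D₂) :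
    0 < D₁ := by
  obtain ⟨_, -, _, -, _, -, _, -, _, -, _, -, _, -, _, -, h⟩ := h
  exact h.pos

/-- Either a slope is infinite, or there is a largest one. -/
lemma Recognizes.exists_isMaxSlope (hχ : Recognizes k N χ (HasRepetition a)) (hk : 1 < k) :
    (∃ D₁, IsSlope k N (k ^ N + N + 1) (HasRepetition a) D₁ 0) ∨
      ∃ D₁ < k ^ N + N + 1, ∃ D₂ < k ^ N + N + 1,
        IsMaxSlope k N (k ^ N + N + 1) (HasRepetition a) D₁ D₂ := by
  by_cases h0 : ∃ D₁, IsSlope k N (k ^ N + N + 1) (HasRepetition a) D₁ 0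
  · exact Or.inl h0
  right
  push Not at h0
  let T : Set (ℕ × ℕ) := {D | D.1 < k ^ N + N + 1 ∧ D.2 < k ^ N + N + 1 ∧
    IsSlope k N (k ^ N + N + 1) (HasRepetition a) D.1 D.2}
  have hfin : T.Finite := ((Set.finite_Iio _).prod (Set.finite_Iio _)).subset
    fun D hD => ⟨hD.1, hD.2.1⟩
  have hne : T.Nonempty := by
    -- The trivial repetition with q = p = k ^ N is already long enough to be cut.
    obtain ⟨D₁, h1, D₂, h2, h3, -⟩ := hχ.exists_isSlope hk (fun q p h => h.2.1)
      (hasRepetition_self (Nat.pow_pos (by omega))) (le_refl (k ^ N))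
    exact ⟨(D₁, D₂), h1, h2, h3⟩
  have hpos : ∀ D ∈ T, 0 < D.2 := by
    rintro ⟨D₁, D₂⟩ ⟨-, -, h⟩
    refine Nat.pos_of_ne_zero fun h' => ?_
    simp only at h' h
    exact h0 D₁ (h' ▸ h)
  obtain ⟨D, hD, hmax⟩ := T.exists_max_image (fun D => (D.1 : ℚ) / D.2) hfin hne
  refine ⟨D.1, hD.1, D.2, hD.2.1, hpos D hD, hD.2.2, fun E₁ h1 E₂ h2 hE => ?_⟩
  have hE' : (E₁, E₂) ∈ T := ⟨h1, h2, hE⟩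
  have h3 := hmax _ hE'
  have h4 : (0 : ℚ) < D.2 := by exact_mod_cast hpos D hD
  have h5 : (0 : ℚ) < E₂ := by exact_mod_cast hpos _ hE'
  rw [div_le_div_iff₀ h5 h4] at h3
  exact_mod_cast h3

variable [NeZero k]

lemma IsSlope.c₂_eq_top {b : ℕ} (hχ : Recognizes k N χ (HasRepetition a)) (hk : 2 ≤ k) {D₁ : ℕ}
    (h : IsSlope k N b (HasRepetition a) D₁ 0) :
    c₂ a = ⊤ ∧ IsSpecialPoint (periodLang k a) ⊤ := by
  obtain ⟨_, -, _, -, _, -, _, -, _, -, _, -, _, -, _, -, h⟩ := h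
  obtain ⟨Q, P, hS, hQ, -, hP, -⟩ := h.exists_seq hχ (by omega)
  have hS' : ∀ m, HasRepetition a (Q m) (P 0) := fun m => hP rfl m ▸ hS m
  exact ⟨AutSeq.c₂_eq_top fun n => ⟨Q n, hQ.id_le n, hS' n⟩, isSpecialPoint_top hk hS' hQ⟩

lemma IsMaxSlope.c₂_eq (hχ : Recognizes k N χ (HasRepetition a)) (hk : 2 ≤ k) {D₁ D₂ : ℕ}
    (h : IsMaxSlope k N (k ^ N + N + 1) (HasRepetition a) D₁ D₂) :
    c₂ a = (((D₁ : ℝ) / D₂ : ℝ) : EReal) ∧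
      IsGreatest {β | IsSpecialPoint (periodLang k a) β} (((D₁ : ℝ) / D₂ : ℝ) : EReal) := by
  obtain ⟨hD₂, hslope, hmax⟩ := h
  have hle := hχ.mul_le hk (fun q p h => h.2.1) hmax
  obtain ⟨_, -, _, -, _, -, _, -, _, -, _, -, _, -, _, -, h⟩ := hslope
  obtain ⟨Q, P, hS, hQ, hP, -, C, hC⟩ := h.exists_seq hχ (by omega)
  exact ⟨le_antisymm (c₂_le hD₂ hle) (le_c₂_of_const hD₂ hS (hP hD₂) hC),
    isSpecialPoint_of_const hk hD₂ hS hQ (hP hD₂) hC, fun β hβ => hβ.le hk hD₂ hle⟩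

end SlopeValue

/-! ### The automaton recognizing repetitions -/

section Automata

variable {k n : ℕ} [NeZero k] {Δ : Type*} (M : DFAO k n Δ)

/-- The state reached after reading `(i)_k`; reading nothing leads to an additional state. -/
def DFAO.natState (i : ℕ) : Option (Fin n) :=
  if i = 0 then none else some ((natWord k i).foldl M.step M.start)

/-- The output on the states of `DFAO.natState`. -/
def DFAO.natOut : Option (Fin n) → Δ
  | none => M.out M.start
  | some s => M.out s

lemma DFAO.natOut_natState (i : ℕ) : M.natOut (M.natState i) = M.seq i := by
  by_cases h : i = 0
  · subst h
    simp [natOut, natState, seq, natWord]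
  · simp [natOut, natState, seq, h]

lemma natWord_mul_add (hk : 2 ≤ k) {m r : ℕ} (hr : r < k) (h : k * m + r ≠ 0) :
    natWord k (k * m + r) = natWord k m ++ [Fin.ofNat k r] := by
  rw [natWord, natWord, add_comm, Nat.digits_add k (by omega) r m hr (by
    by_contra! h'
    simp [h'.1, h'.2] at h)]
  simp

/-- The extra state marks the value 0, whose leading zeros are never fed to `M`; `M` itself may
react to them. -/
lemma DFAO.natState_mul_add (hk : 2 ≤ k) {m m' r : ℕ} (hr : r < k)
    (h : M.natState m = M.natState m') :
    M.natState (k * m + r) = M.natState (k * m' + r) := by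
  by_cases h0 : m = 0
  · have : m' = 0 := by
      by_contra h'
      simp [natState, h0, h'] at h
    rw [h0, this]
  have h0' : m' ≠ 0 := by
    intro h'
    simp [natState, h0, h'] at h
  have h1 : k * m + r ≠ 0 := by positivity
  have h2 : k * m' + r ≠ 0 := by positivity
  simp only [natState, h0, h0', h1, h2, if_false, Option.some_inj] at h ⊢
  rw [natWord_mul_add hk hr h1, natWord_mul_add hk hr h2, List.foldl_append, List.foldl_append, h]

/-- With the most significant digit first, the carry of a sum is not yet known, so the states for
both m and m + 1 are tracked. -/
lemma DFAO.natState_mul_add_carry (hk : 2 ≤ k) {m m' c : ℕ} (hc : c < 2 * k)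
    (h : M.natState m = M.natState m') (h' : M.natState (m + 1) = M.natState (m' + 1)) :
    M.natState (k * m + c) = M.natState (k * m' + c) := by
  by_cases hck : c < k
  · exact M.natState_mul_add hk hck h
  · have := M.natState_mul_add hk (r := c - k) (by omega) h'
    rwa [mul_add, mul_add, mul_one, add_assoc, add_assoc, Nat.add_sub_cancel' (by omega)] at this

/-- An integer up to the distinction of the integers that are at most `-2`, and of those that are
at least `2`. -/
def clamp (d : ℤ) : Fin 5 :=
  if d ≤ -2 then 0 else if d = -1 then 1 else if d = 0 then 2 else if d = 1 then 3 else 4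

lemma clamp_eq_iff {d d' : ℤ} :
    clamp d = clamp d' ↔ d = d' ∨ (2 ≤ d ∧ 2 ≤ d') ∨ (d ≤ -2 ∧ d' ≤ -2) := by
  unfold clamp
  split_ifs <;> simp <;> omega

/-- If d ≥ 2 then kd + r ≥ 2k - (2k - 2) = 2, and symmetrically for d ≤ -2: the merged classes are
never left. -/
lemma clamp_mul_add {d d' r : ℤ} {k : ℕ} (h : clamp d = clamp d') (h1 : -(2 * k) + 2 ≤ r)
    (h2 : r ≤ 2 * k - 2) : clamp (k * d + r) = clamp (k * d' + r) := by
  rw [clamp_eq_iff] at h ⊢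
  rcases h with rfl | ⟨h, h'⟩ | ⟨h, h'⟩
  · exact Or.inl rfl
  · exact Or.inr (Or.inl ⟨by nlinarith, by nlinarith⟩)
  · exact Or.inr (Or.inr ⟨by nlinarith, by nlinarith⟩)

/-- The states of an automaton that reads quadruples `(q, p, i, u)` and decides whether
`1 ≤ p ≤ q` and whether the letters at `u` and `u + p` agree if they lie in the factor of length
`q` at position `i`. -/
abbrev RepState (n : ℕ) : Type :=
  (Option (Fin n) × Option (Fin n) × Option (Fin n)) × (Fin 5 × Fin 5 × Fin 5 × Fin 5)

/-- The state map of the automaton described at `RepState`. -/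
def DFAO.repState (v : Fin 4 → ℕ) : RepState n :=
  -- The coordinates are q, p, i, u in this order; u + p + 1 serves only the carry.
  ((M.natState (v 3), M.natState (v 3 + v 1), M.natState (v 3 + v 1 + 1)),
    (clamp ((v 3 : ℤ) - v 2), clamp ((v 2 : ℤ) + v 0 - v 3 - v 1), clamp (v 1),
      clamp ((v 0 : ℤ) - v 1)))

lemma DFAO.digitCongr_repState (hk : 2 ≤ k) : DigitCongr k M.repState := by
  intro v w r hr h
  simp only [repState, Prod.mk.injEq] at h ⊢
  obtain ⟨⟨h1, h2, h3⟩, h4, h5, h6, h7⟩ := h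
  have hr0 := hr 0
  have hr1 := hr 1
  have hr2 := hr 2
  have hr3 := hr 3
  refine ⟨⟨M.natState_mul_add hk hr3 h1, ?_, ?_⟩, ?_, ?_, ?_, ?_⟩
  · have := M.natState_mul_add_carry hk (c := r 3 + r 1) (by omega) h2 h3
    convert this using 2 <;> ring
  · have := M.natState_mul_add_carry hk (c := r 3 + r 1 + 1) (by omega) h2 h3
    convert this using 2 <;> ring
  · have := clamp_mul_add (k := k) (r := (r 3 : ℤ) - r 2) h4 (by omega) (by omega)
    convert this using 2 <;> push_cast <;> ring
  · have := clamp_mul_add (k := k) (r := (r 2 : ℤ) + r 0 - r 3 - r 1) h5 (by omega) (by omega)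
    convert this using 2 <;> push_cast <;> ring
  · have := clamp_mul_add (k := k) (r := (r 1 : ℤ)) h6 (by omega) (by omega)
    push_cast
    exact this
  · have := clamp_mul_add (k := k) (r := (r 0 : ℤ) - r 1) h7 (by omega) (by omega)
    convert this using 2 <;> push_cast <;> ring

/-- The factor of `a` of length `q` at position `i` has period `p`, where `1 ≤ p ≤ q`. -/
def HasRepetitionAt (a : ℕ → Δ) (q p i : ℕ) : Prop :=
  1 ≤ p ∧ p ≤ q ∧ ∀ j < q, j + p < q → a (i + j) = a (i + j + p)

/-- The redundant bound j < q makes the quantifier bounded, as the algorithm needs. -/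
lemma hasRepetition_iff_exists_at {a : ℕ → Δ} {q p : ℕ} :
    HasRepetition a q p ↔ ∃ i, HasRepetitionAt a q p i := by
  constructor
  · rintro ⟨h1, h2, i, h3⟩
    exact ⟨i, h1, h2, fun j _ => h3 j⟩
  · rintro ⟨i, h1, h2, h3⟩
    exact ⟨h1, h2, i, fun j hj => h3 j (by omega) hj⟩

/-- The set of states of `DFAO.repState` that occur for given `q`, `p`, `i`. -/
def DFAO.repStates (q p i : ℕ) : Set (RepState n) :=
  projState 3 M.repState ![q, p, i, 0]

/-- A condition on all u depends only on the set of states that occur, so the subset construction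
also handles this universal quantifier. -/
lemma DFAO.repStates_congr {q p i q' p' i' : ℕ} (h : M.repStates q p i = M.repStates q' p' i')
    (hr : HasRepetitionAt M.seq q p i) : HasRepetitionAt M.seq q' p' i' := by
  have key : ∀ u', ∃ u, M.repState ![q, p, i, u] = M.repState ![q', p', i', u'] := by
    intro u'
    obtain ⟨u, hu⟩ : M.repState (Function.update ![q', p', i', 0] 3 u') ∈ M.repStates q p i :=
      h ▸ ⟨u', rfl⟩
    refine ⟨u, ?_⟩
    convert hu using 2 <;> ext j <;> fin_cases j <;> rfl
  obtain ⟨h1, h2, h3⟩ := hr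
  simp only [repState, Prod.mk.injEq, clamp_eq_iff, Matrix.cons_val] at key
  refine ⟨?_, ?_, fun j _ hj => ?_⟩
  · obtain ⟨u, -, -, -, h6, -⟩ := key 0
    omega
  · obtain ⟨u, -, -, -, -, h7⟩ := key 0
    omega
  · obtain ⟨u, ⟨h4, h5, -⟩, h6, h7, -, -⟩ := key (i' + j)
    obtain ⟨j', rfl⟩ : ∃ j', u = i + j' := ⟨u - i, by omega⟩
    have := h3 j' (by omega) (by omega)
    rwa [← M.natOut_natState, ← M.natOut_natState, h4, h5, M.natOut_natState,
      M.natOut_natState] at this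

/-- The state map of an automaton that recognizes `HasRepetition M.seq`. -/
def DFAO.pairState (q p : ℕ) : Set (Set (RepState n)) :=
  projState 2 (projState 3 M.repState) ![q, p, 0, 0]

/-- The number of states of `DFAO.pairState`. -/
def numStates (n : ℕ) : ℕ :=
  2 ^ 2 ^ ((n + 1) ^ 3 * 625)

/-- Three components with n + 1 values, 5 ^ 4 = 625 clamped differences, two subset constructions.
-/
lemma card_set_repState : Nat.card (Set (Set (RepState n))) = numStates n := by
  simp [numStates, Nat.card_eq_fintype_card]
  ring_nf

lemma DFAO.pairState_eq (q p : ℕ) :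
    M.pairState q p = Set.range fun i => M.repStates q p i := by
  unfold pairState projState repStates projState
  congr! 7 with i u
  ext j
  fin_cases j <;> rfl

theorem DFAO.recognizes (hk : 2 ≤ k) :
    Recognizes k (numStates n) M.pairState (HasRepetition M.seq) where
  card := card_set_repState.le
  append {e q p q' p' r s} hr hs h := by
    have h0 : ∀ i, (![r, s, 0, 0] : Fin 4 → ℕ) i < k ^ e := by
      have : 0 < k ^ e := by positivity
      intro i
      fin_cases i <;> simpa
    have := (((M.digitCongr_repState hk).projState (by omega) 3).projState (by omega) 2).pow e
      _ _ _ h0 h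
    have hv : ∀ x y : ℕ, (fun i => k ^ e * (![x, y, 0, 0] : Fin 4 → ℕ) i + ![r, s, 0, 0] i) =
        ![k ^ e * x + r, k ^ e * y + s, 0, 0] := fun x y => by
      ext j
      fin_cases j <;> simp
    rwa [hv, hv] at this
  mem {q p q' p'} h hS := by
    rw [hasRepetition_iff_exists_at] at hS ⊢
    obtain ⟨i, hi⟩ := hS
    rw [M.pairState_eq, M.pairState_eq] at h
    obtain ⟨i', hi'⟩ := h.subset ⟨i, rfl⟩
    exact ⟨i', M.repStates_congr hi'.symm hi⟩

/-- A repetition occurs at a bounded position if it occurs at all. -/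
lemma DFAO.hasRepetition_iff (hk : 2 ≤ k) {q p : ℕ} : HasRepetition M.seq q p ↔
    ∃ i < k ^ (q + numStates n), HasRepetitionAt M.seq q p i := by
  rw [hasRepetition_iff_exists_at]
  refine ⟨?_, fun ⟨i, _, hi⟩ => ⟨i, hi⟩⟩
  rintro ⟨i, hi⟩
  -- Only u is projected away here, since i is the coordinate to be bounded.
  have hcard : Nat.card (Set (RepState n)) ≤ numStates n := by
    rw [← card_set_repState, Nat.card_eq_fintype_card, Nat.card_eq_fintype_card,
      Fintype.card_set (α := Set _)]
    exact Nat.lt_two_pow_self.le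
  have hq : q < k ^ q := Nat.lt_pow_self (by omega)
  obtain ⟨i', hi', h⟩ := ((M.digitCongr_repState hk).projState (by omega) 3).exists_lt_update
    (by omega) hcard 2 (m := q) ![q, p, 0, 0] (by
      intro j hj
      have := hi.2.1
      fin_cases j <;> simp at hj ⊢ <;> omega) i
  refine ⟨i', hi', M.repStates_congr (q := q) (p := p) (i := i) ?_ hi⟩
  convert h.symm using 2 <;> unfold repStates <;> congr 1 <;> ext j <;> fin_cases j <;> rfl

end Automata

/-! ### Primitive recursiveness of the slope predicates -/

section PrimitiveRecursion

attribute [fun_prop] Primrec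
attribute [fun_prop] Primrec.id Primrec.const Primrec.comp

variable {α β γ : Type*} [Primcodable α] [Primcodable β] [Primcodable γ]

@[fun_prop] lemma primrec_fst {f : α → β × γ} (hf : Primrec f) : Primrec fun a => (f a).1 :=
  Primrec.fst.comp hf

@[fun_prop] lemma primrec_snd {f : α → β × γ} (hf : Primrec f) : Primrec fun a => (f a).2 :=
  Primrec.snd.comp hf

@[fun_prop] lemma primrec_mk {f : α → β} {g : α → γ} (hf : Primrec f) (hg : Primrec g) :
    Primrec fun a => (f a, g a) :=
  hf.pair hg

variable {f g : α → ℕ}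

@[fun_prop] lemma primrec_add (hf : Primrec f) (hg : Primrec g) : Primrec fun a => f a + g a :=
  Primrec.nat_add.comp hf hg

@[fun_prop] lemma primrec_sub (hf : Primrec f) (hg : Primrec g) : Primrec fun a => f a - g a :=
  Primrec.nat_sub.comp hf hg

@[fun_prop] lemma primrec_mul (hf : Primrec f) (hg : Primrec g) : Primrec fun a => f a * g a :=
  Primrec.nat_mul.comp hf hg

@[fun_prop] lemma primrec_div (hf : Primrec f) (hg : Primrec g) : Primrec fun a => f a / g a :=
  Primrec.nat_div.comp hf hg

@[fun_prop] lemma primrec_mod (hf : Primrec f) (hg : Primrec g) : Primrec fun a => f a % g a :=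
  Primrec.nat_mod.comp hf hg

@[fun_prop] lemma primrec_pow (hf : Primrec f) (hg : Primrec g) : Primrec fun a => f a ^ g a :=
  (Primrec₂.unpaired'.1 Nat.Primrec.pow).comp hf hg

@[fun_prop] lemma primrec_length {l : α → List β} (hl : Primrec l) :
    Primrec fun a => (l a).length :=
  Primrec.list_length.comp hl

@[fun_prop] lemma primrec_getD {l : α → List β} (hl : Primrec l) (hf : Primrec f) (d : β) :
    Primrec fun a => (l a).getD (f a) d :=
  (Primrec.list_getD d).comp hl hf

@[fun_prop] lemma primrec_unpair (hf : Primrec f) : Primrec fun a => (f a).unpair :=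
  Primrec.unpair.comp hf

@[fun_prop] lemma primrec_pump {K y x m : α → ℕ} (hK : Primrec K) (hy : Primrec y)
    (hx : Primrec x) (hm : Primrec m) : Primrec fun a => pump (K a) (y a) (x a) (m a) :=
  Primrec.nat_rec' (h := fun a v => K a * v.2 + y a) hm hx
    (show Primrec fun v : α × ℕ × ℕ => K v.1 * v.2.2 + y v.1 by fun_prop)

@[fun_prop] lemma primrec_numStates (hf : Primrec f) : Primrec fun a => numStates (f a) := by
  unfold numStates
  fun_prop

lemma primrecPred_lt (hf : Primrec f) (hg : Primrec g) : PrimrecPred fun a => f a < g a :=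
  Primrec.nat_lt.comp hf hg

lemma primrecPred_le (hf : Primrec f) (hg : Primrec g) : PrimrecPred fun a => f a ≤ g a :=
  Primrec.nat_le.comp hf hg

lemma primrecPred_eq (hf : Primrec f) (hg : Primrec g) : PrimrecPred fun a => f a = g a :=
  Primrec.eq.comp hf hg

lemma primrecPred_imp {p q : α → Prop} (hp : PrimrecPred p) (hq : PrimrecPred q) :
    PrimrecPred fun a => p a → q a :=
  (hp.not.or hq).of_eq fun _ => imp_iff_not_or.symm

lemma primrecPred_exists_lt {P : α → ℕ → Prop} (hf : Primrec f)
    (hP : PrimrecPred fun v : α × ℕ => P v.1 v.2) : PrimrecPred fun a => ∃ x < f a, P a x :=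
  ((PrimrecRel.exists_mem_list (R := fun (x : ℕ) (a : α) => P a x)
    (hP.comp (show Primrec fun v : ℕ × α => (v.2, v.1) by fun_prop))).comp
    (Primrec.list_range.comp hf) Primrec.id).of_eq fun a => by simp

lemma primrecPred_forall_lt {P : α → ℕ → Prop} (hf : Primrec f)
    (hP : PrimrecPred fun v : α × ℕ => P v.1 v.2) : PrimrecPred fun a => ∀ x < f a, P a x :=
  ((PrimrecRel.forall_mem_list (R := fun (x : ℕ) (a : α) => P a x)
    (hP.comp (show Primrec fun v : ℕ × α => (v.2, v.1) by fun_prop))).comp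
    (Primrec.list_range.comp hf) Primrec.id).of_eq fun a => by simp

lemma primrecPred_comp₃ {S : α → ℕ → ℕ → Prop}
    (hS : PrimrecPred fun v : α × ℕ × ℕ => S v.1 v.2.1 v.2.2) {c : β → α} {q p : β → ℕ}
    (hc : Primrec c) (hq : Primrec q) (hp : Primrec p) :
    PrimrecPred fun b => S (c b) (q b) (p b) :=
  hS.comp (hc.pair (hq.pair hp))

lemma isLasso_iff {k N : ℕ} {S : ℕ → ℕ → Prop} {D₁ D₂ x₁ x₂ e y₁ y₂ f z₁ z₂ : ℕ} :
    IsLasso k N S D₁ D₂ x₁ x₂ e y₁ y₂ f z₁ z₂ ↔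
      0 < D₁ ∧ y₁ < k ^ e ∧ y₂ < k ^ e ∧ z₁ < k ^ f ∧ z₂ < k ^ f ∧
        D₁ + x₁ = k ^ e * x₁ + y₁ ∧ D₂ + x₂ = k ^ e * x₂ + y₂ ∧
        ∀ m < N + 1,
          S (k ^ f * pump (k ^ e) y₁ x₁ m + z₁) (k ^ f * pump (k ^ e) y₂ x₂ m + z₂) :=
  ⟨fun h => ⟨h.1, h.2, h.3, h.4, h.5, h.6, h.7, h.8⟩,
    fun ⟨h1, h2, h3, h4, h5, h6, h7, h8⟩ => ⟨h1, h2, h3, h4, h5, h6, h7, h8⟩⟩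

section Slopes

variable {S : α → ℕ → ℕ → Prop} {k N b : α → ℕ}

lemma primrecPred_isSlope (hS : PrimrecPred fun v : α × ℕ × ℕ => S v.1 v.2.1 v.2.2)
    (hk : Primrec k) (hN : Primrec N) (hb : Primrec b) :
    PrimrecPred fun v : α × ℕ × ℕ => IsSlope (k v.1) (N v.1) (b v.1) (S v.1) v.2.1 v.2.2 := by
  unfold IsSlope
  simp only [isLasso_iff]
  iterate 8 refine primrecPred_exists_lt (by fun_prop) ?_
  refine .and (primrecPred_lt (by fun_prop) (by fun_prop)) <|
    .and (primrecPred_lt (by fun_prop) (by fun_prop)) <|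
    .and (primrecPred_lt (by fun_prop) (by fun_prop)) <|
    .and (primrecPred_lt (by fun_prop) (by fun_prop)) <|
    .and (primrecPred_lt (by fun_prop) (by fun_prop)) <|
    .and (primrecPred_eq (by fun_prop) (by fun_prop)) <|
    .and (primrecPred_eq (by fun_prop) (by fun_prop)) <|
    primrecPred_forall_lt (by fun_prop) ?_
  exact primrecPred_comp₃ hS (by fun_prop) (by fun_prop) (by fun_prop)

lemma primrecPred_isMaxSlope (hS : PrimrecPred fun v : α × ℕ × ℕ => S v.1 v.2.1 v.2.2)
    (hk : Primrec k) (hN : Primrec N) (hb : Primrec b) :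
    PrimrecPred fun v : α × ℕ × ℕ => IsMaxSlope (k v.1) (N v.1) (b v.1) (S v.1) v.2.1 v.2.2 := by
  have hslope := primrecPred_isSlope hS hk hN hb
  unfold IsMaxSlope
  refine .and (primrecPred_lt (by fun_prop) (by fun_prop)) <| .and hslope <|
    primrecPred_forall_lt (by fun_prop) <| primrecPred_forall_lt (by fun_prop) <|
    primrecPred_imp ?_ (primrecPred_le (by fun_prop) (by fun_prop))
  exact primrecPred_comp₃ (S := fun a => IsSlope (k a) (N a) (b a) (S a)) hslope (by fun_prop) (by fun_prop) (by fun_prop)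

end Slopes

end PrimitiveRecursion

/-! ### The algorithm and its correctness -/

section Algorithm

/-- The descriptions of automata, see `DFAO.code`. -/
abbrev Code : Type := ℕ × ℕ × List (List ℕ) × List ℕ

/-- The state reached after reading the first `t` of the `i` base-`k` digits of `i`, with leading
zeros ignored. -/
def codeState (c : Code) (i t : ℕ) : ℕ :=
  Nat.rec c.2.1 (fun t s => if i / c.1 ^ (i - (t + 1)) = 0 then c.2.1 else
    (c.2.2.1.getD s []).getD (i / c.1 ^ (i - (t + 1)) % c.1) 0) t

/-- The sequence generated by the automaton with the given description. -/
def codeSeq (c : Code) (i : ℕ) : ℕ :=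
  c.2.2.2.getD (codeState c i i) 0

/-- The number of states used for the repetitions in `codeSeq c`. -/
def codeNumStates (c : Code) : ℕ :=
  numStates c.2.2.1.length

/-- The decidable form of `HasRepetition (codeSeq c)`. -/
def CodeRepetition (c : Code) (q p : ℕ) : Prop :=
  ∃ i < c.1 ^ (q + codeNumStates c), HasRepetitionAt (codeSeq c) q p i

/-- The number `t` encodes a largest slope for the automaton with the given description. -/
def CodeMaxSlope (c : Code) (t : ℕ) : Prop :=
  IsMaxSlope c.1 (codeNumStates c) (c.1 ^ codeNumStates c + codeNumStates c + 1)
    (CodeRepetition c) t.unpair.1 t.unpair.2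

open Classical in
/-- The algorithm that computes `c₂`. -/
noncomputable def c₂Algorithm (c : Code) : Option (ℕ × ℕ) :=
  -- Any hit gives the value. Without a hit the result is 0, which encodes (0, 0) and fails the test
  -- below.
  let t := Nat.findGreatest (CodeMaxSlope c)
    ((c.1 ^ codeNumStates c + codeNumStates c + 1) ^ 2)
  if CodeMaxSlope c t then some t.unpair else none

variable {α : Type*} [Primcodable α]

@[fun_prop] lemma primrec_codeState {c : α → Code} {i t : α → ℕ} (hc : Primrec c)
    (hi : Primrec i) (ht : Primrec t) : Primrec fun a => codeState (c a) (i a) (t a) :=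
  Primrec.nat_rec' (h := fun a v => if i a / (c a).1 ^ (i a - (v.1 + 1)) = 0 then (c a).2.1 else
    ((c a).2.2.1.getD v.2 []).getD (i a / (c a).1 ^ (i a - (v.1 + 1)) % (c a).1) 0) ht
    (by fun_prop) <| Primrec.ite (primrecPred_eq (by fun_prop) (by fun_prop)) (by fun_prop)
    (by fun_prop)

@[fun_prop] lemma primrec_codeSeq {c : α → Code} {i : α → ℕ} (hc : Primrec c)
    (hi : Primrec i) : Primrec fun a => codeSeq (c a) (i a) := by
  unfold codeSeq
  fun_prop

@[fun_prop] lemma primrec_codeNumStates {c : α → Code} (hc : Primrec c) :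
    Primrec fun a => codeNumStates (c a) := by
  unfold codeNumStates
  fun_prop

lemma primrecPred_codeRepetition :
    PrimrecPred fun v : Code × ℕ × ℕ => CodeRepetition v.1 v.2.1 v.2.2 := by
  unfold CodeRepetition HasRepetitionAt
  refine primrecPred_exists_lt (by fun_prop) <|
    .and (primrecPred_le (by fun_prop) (by fun_prop)) <|
    .and (primrecPred_le (by fun_prop) (by fun_prop)) <|
    primrecPred_forall_lt (by fun_prop) <|
    primrecPred_imp (primrecPred_lt (by fun_prop) (by fun_prop))
      (primrecPred_eq (by fun_prop) (by fun_prop))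

lemma primrecRel_codeMaxSlope : PrimrecRel CodeMaxSlope :=
  (primrecPred_isMaxSlope (k := fun c : Code => c.1) (N := codeNumStates)
    (b := fun c => c.1 ^ codeNumStates c + codeNumStates c + 1) primrecPred_codeRepetition
    (by fun_prop) (by fun_prop) (by fun_prop)).comp
    (f := fun v : Code × ℕ => (v.1, v.2.unpair.1, v.2.unpair.2)) (by fun_prop)

lemma primrec_c₂Algorithm : Primrec c₂Algorithm := by
  classical
  have h1 : Primrec fun c : Code => Nat.findGreatest (CodeMaxSlope c)
      ((c.1 ^ codeNumStates c + codeNumStates c + 1) ^ 2) :=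
    Primrec.nat_findGreatest (by fun_prop) primrecRel_codeMaxSlope
  exact Primrec.ite (primrecRel_codeMaxSlope.comp Primrec.id h1)
    (Primrec.option_some.comp (by fun_prop)) (by fun_prop)

lemma codeNumStates_code {k n : ℕ} (M : DFAO k n ℕ) :
    codeNumStates M.code = numStates n := by
  simp [codeNumStates, DFAO.code]

variable {k n : ℕ} [NeZero k] (M : DFAO k n ℕ)

/-- Since i < k ^ i, reading i digits suffices. States and digits stay in range, so the `getD`
defaults are never used. -/
lemma codeState_code (hk : 2 ≤ k) (i t : ℕ) (ht : t ≤ i) : codeState M.code i t =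
    ((natWord k (i / k ^ (i - t))).foldl M.step M.start : Fin n) := by
  induction t with
  | zero =>
    rw [Nat.sub_zero, Nat.div_eq_of_lt (Nat.lt_pow_self hk)]
    simp [codeState, natWord, DFAO.code]
  | succ t ih =>
    have h1 : codeState M.code i (t + 1) = if i / k ^ (i - (t + 1)) = 0 then (M.start : ℕ) else
        (M.code.2.2.1.getD (codeState M.code i t) []).getD (i / k ^ (i - (t + 1)) % k) 0 := rfl
    rw [h1, ih (by omega)]
    obtain ⟨v, hv⟩ : ∃ v, v = i / k ^ (i - (t + 1)) := ⟨_, rfl⟩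
    have h2 : i / k ^ (i - t) = v / k := by
      rw [hv, Nat.div_div_eq_div_mul, ← pow_succ]
      congr 2
      omega
    rw [← hv, h2]
    split_ifs with h0
    · simp [h0, natWord]
    · have h3 : v % k < k := Nat.mod_lt _ (by omega)
      have h4 := natWord_mul_add hk h3 (m := v / k) (by rwa [Nat.div_add_mod])
      rw [Nat.div_add_mod] at h4
      rw [h4, List.foldl_append]
      simp [DFAO.code, List.getD_eq_getElem?_getD, h3, Fin.ofNat, Nat.mod_eq_of_lt h3]

lemma codeSeq_code (hk : 2 ≤ k) : codeSeq M.code = M.seq := by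
  funext i
  rw [codeSeq, codeState_code M hk i i le_rfl]
  simp [DFAO.code, DFAO.seq, List.getD_eq_getElem?_getD]

lemma codeRepetition_code (hk : 2 ≤ k) : CodeRepetition M.code = HasRepetition M.seq := by
  funext q p
  rw [M.hasRepetition_iff hk, CodeRepetition, codeSeq_code M hk, codeNumStates_code]
  rfl

lemma codeMaxSlope_code (hk : 2 ≤ k) (t : ℕ) : CodeMaxSlope M.code t ↔
    IsMaxSlope k (numStates n) (k ^ numStates n + numStates n + 1) (HasRepetition M.seq)
      t.unpair.1 t.unpair.2 := by
  rw [CodeMaxSlope, codeRepetition_code M hk, codeNumStates_code]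
  rfl

theorem c₂Algorithm_correct (hk : 2 ≤ k) :
    (∀ m d : ℕ, c₂Algorithm M.code = some (m, d) → d ≠ 0) ∧
      c₂ M.seq = outputVal (c₂Algorithm M.code) := by
  classical
  have hχ := M.recognizes hk
  unfold c₂Algorithm
  simp only
  split_ifs with h
  · rw [codeMaxSlope_code M hk] at h
    refine ⟨fun m d hmd => ?_, (h.c₂_eq hχ hk).1⟩
    have : d = (Nat.unpair _).2 := (congrArg Prod.snd (Option.some_inj.1 hmd)).symm
    rw [this]
    exact h.1.ne'
  · refine ⟨by rintro _ _ ⟨⟩, ?_⟩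
    rcases hχ.exists_isMaxSlope hk with ⟨D₁, hD⟩ | ⟨D₁, h1, D₂, h2, hD⟩
    · exact (hD.c₂_eq_top hχ hk).1
    · refine absurd (Nat.findGreatest_spec (P := CodeMaxSlope M.code) (m := Nat.pair D₁ D₂) ?_ ?_) h
      · rw [codeNumStates_code]
        refine (Nat.pair_lt_max_add_one_sq D₁ D₂).le.trans (Nat.pow_le_pow_left ?_ 2)
        exact max_lt h1 h2
      · rw [codeMaxSlope_code M hk, Nat.unpair_pair]
        exact hD

end Algorithm

end AutSeq

theorem mainTheorem6 :
    (∀ (k : ℕ) [NeZero k], 2 ≤ k → ∀ (Δ : Type*) (a : ℕ → Δ), AutSeq.IsAutomatic k a →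
      (AutSeq.c₂ a = ⊤ ∨ ∃ r : ℚ, AutSeq.c₂ a = ((r : ℝ) : EReal)) ∧
      IsGreatest {β : EReal | AutSeq.IsSpecialPoint (AutSeq.periodLang k a) β} (AutSeq.c₂ a)) ∧
    (∃ F : ℕ × ℕ × List (List ℕ) × List ℕ → Option (ℕ × ℕ), Computable F ∧
      ∀ (k : ℕ) [NeZero k], 2 ≤ k → ∀ (n : ℕ) (M : AutSeq.DFAO k n ℕ),
        (∀ m d : ℕ, F M.code = some (m, d) → d ≠ 0) ∧
        AutSeq.c₂ M.seq = AutSeq.outputVal (F M.code)) := by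
  refine ⟨fun k _ hk Δ a ha => ?_, AutSeq.c₂Algorithm, AutSeq.primrec_c₂Algorithm.to_comp,
    fun k _ hk n M => AutSeq.c₂Algorithm_correct M hk⟩
  obtain ⟨n, M, rfl⟩ := ha
  have hχ := M.recognizes hk
  rcases hχ.exists_isMaxSlope hk with ⟨D₁, hD⟩ | ⟨D₁, -, D₂, -, hD⟩
  · obtain ⟨h1, h2⟩ := hD.c₂_eq_top hχ hk
    rw [h1]
    exact ⟨Or.inl rfl, h2, fun _ _ => le_top⟩
  · obtain ⟨h1, h2⟩ := hD.c₂_eq hχ hk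
    rw [h1]
    exact ⟨Or.inr ⟨(D₁ : ℚ) / D₂, by push_cast; rfl⟩, h2⟩
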